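/- **Setting.** Let $d\in\{2,3,4,\dots\}\cup\{\infty\}$, and let $\{1,\dots,d\}$ mean the set of all positive integers when $d=\infty$. Let $\mathbb C^d$ be the Euclidean space (for $d=\infty$: the Hilbert space of square-summable sequences), $\mathbb B_d$ its open unit ball, and $\mathbb H_0=\{s\in\mathbb C:\operatorname{Re}s>0\}$. Let $H^2_d$ be the Drury–Arveson space, i.e. the reproducing kernel Hilbert space on $\mathbb B_d$ with kernel $\frac1{1-\langle z,w\rangle}$, and let $\mathcal M(H^2_d)$ be the set of its multipliers, i.e. of the functions $g:\mathbb B_d\to\mathbb C$ with $gh\in H^2_d$ for all $h\in H^2_d$. A pair $(\mathbf b,\mathbf n)$ of $d$-tuples satisfies property (P) if $\mathbf n=(n_j)_{j=1}^d$ consists of distinct integers $n_j\ge 2$, $\mathbf b=(b_j)_{j=1}^d$ consists of positive real numbers, and either $\sum_j b_j=1$, or $\sum_j b_j<1$ and the Dirichlet series $\sum_j b_jn_j^{-s}$ has abscissa of absolute convergence $0$. In this case $f_{\mathbf b,\mathbf n}(s)=(\sqrt{b_j}\,n_j^{-s})_{j=1}^d$ defines a map $\mathbb H_0\to\mathbb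 B_d$, and the multiplier variety associated with the kernel $K_{\mathbf b,\mathbf n}(s,u)=\frac1{1-\sum_j b_jn_j^{-s-\overline u}}$ is $$V=\{z\in\mathbb B_d: g(z)=0\text{ for all } g\in\mathcal M(H^2_d)\text{ that vanish on } f_{\mathbf b,\mathbf n}(\mathbb H_0)\}.$$ Let $\mathcal J(\mathbf n)$ be the collection of all $J\subseteq\{1,\dots,d\}$ such that $\{\ln n_j:j\in J\}$ is linearly dependent over $\mathbb Q$ while $\{\ln n_j:j\in I\}$ is linearly independent over $\mathbb Q$ for every proper subset $I$ of $J$; such a $J$ is finite. For each $J\in\mathcal J(\mathbf n)$ there are a unique partition $\{J_1,J_2\}$ of $J$ into two non-empty sets and a unique tuple $(\beta_i)_{i\in J}$ of positive integers with greatest common divisor $1$ such that $\prod_{i\in J_1}n_i^{\beta_i}=\prod_{i\in J_2}n_i^{\beta_i}$; they are called the partition and the tuple associated with $J\in\mathcal J(\mathbf n)$. Two pairs $(\mathbf b,\mathbf n)$ and $(\mathbf c,\mathbf m)$ of $d$-tuples satisfying (P) admit a similar pattern if $\mathcal J(\mathbf n)=\mathcal J(\mathbf m)$ and, for each $J$ in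 this collection, the partition $\{J_1,J_2\}$ and the tuple $(\beta_i)_{i\in J}$ associated with $J$ are the same whether $J$ is regarded as an element of $\mathcal J(\mathbf n)$ or of $\mathcal J(\mathbf m)$, and $$\prod_{i\in J_1}c_i^{\beta_i}\prod_{i\in J_2}b_i^{\beta_i}=\prod_{i\in J_2}c_i^{\beta_i}\prod_{i\in J_1}b_i^{\beta_i}.$$ **Proposition.** Let $d\in\{2,3,4,\dots\}\cup\{\infty\}$, let $(\mathbf b,\mathbf n)$ and $(\mathbf c,\mathbf m)$ be pairs of $d$-tuples that both satisfy property (P), and let $V_1$ and $V_2$ be the multiplier varieties associated with $K_{\mathbf b,\mathbf n}$ and $K_{\mathbf c,\mathbf m}$. Then $(\mathbf b,\mathbf n)$ and $(\mathbf c,\mathbf m)$ admit a similar pattern if and only if $V_1=V_2$. -/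

import Mathlib

noncomputable section

open scoped ComplexOrder

/-! ### The unit ball and the Drury–Arveson space -/

/-- The index set `{1, …, d}` for `d ∈ ℕ ∪ {∞}`; for `d = ∞` it is the set of all integers `≥ 1`. -/
abbrev Idx (d : ℕ∞) : Type := {j : ℕ // 1 ≤ j ∧ (j : ℕ∞) ≤ d}

/-- The Hilbert space `ℓ²(ι)`: it is `ℂ^d` with the Euclidean norm when `ι` has `d` elements, and
the space of square-summable sequences when `ι` is countably infinite. -/
abbrev HilbertCoord (ι : Type) : Type := lp (fun _ : ι => ℂ) 2

/-- The open unit ball `𝔹_d` of `ℂ^d`. -/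
abbrev UnitBall (ι : Type) : Type := Metric.ball (0 : HilbertCoord ι) 1

/-- The scalar kernel `1 / (1 - ⟨z, w⟩)` on the ball. The inner product of the mathematical text is
linear in its first argument, Mathlib's in its second, so `⟨z, w⟩` is `inner ℂ w z`. -/
def druryArvesonFun (ι : Type) (z w : UnitBall ι) : ℂ :=
  1 / (1 - inner ℂ (w : HilbertCoord ι) (z : HilbertCoord ι))

/-- The Drury–Arveson kernel, each value being regarded as the operator on `ℂ` that multiplies
by it. -/
def druryArvesonKernel (ι : Type) : Matrix (UnitBall ι) (UnitBall ι) (ℂ →L[ℂ] ℂ) :=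
  Matrix.of fun z w => druryArvesonFun ι z w • ContinuousLinearMap.id ℂ ℂ

theorem norm_inner_lt_one {ι : Type} (z w : UnitBall ι) :
    ‖inner ℂ (w : HilbertCoord ι) (z : HilbertCoord ι)‖ < 1 := by
  have hz : ‖(z : HilbertCoord ι)‖ < 1 := mem_ball_zero_iff.mp z.2
  have hw : ‖(w : HilbertCoord ι)‖ < 1 := mem_ball_zero_iff.mp w.2
  refine (norm_inner_le_norm _ _).trans_lt ?_
  nlinarith [norm_nonneg (z : HilbertCoord ι), norm_nonneg (w : HilbertCoord ι)]

theorem posSemidef_gram {X E : Type} [NormedAddCommGroup E] [InnerProductSpace ℂ E] (v : X → E) :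
    (Matrix.of fun x y : X => inner ℂ (v x) (v y)).PosSemidef := by
  refine ⟨?_, fun u => ?_⟩
  · ext x y
    simp [Matrix.conjTranspose_apply]
  · have h : (u.sum fun x a => u.sum fun y a' => star a * inner ℂ (v x) (v y) * a') =
        inner ℂ (u.sum fun x a => a • v x) (u.sum fun x a => a • v x) := by
      rw [Finsupp.sum_inner]
      refine Finsupp.sum_congr fun x _ => ?_
      rw [Finsupp.inner_sum]
      refine Finsupp.sum_congr fun y _ => ?_
      simp only [inner_smul_left, inner_smul_right, RCLike.star_def]
      ring
    simp only [Matrix.of_apply]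
    rw [h]
    rw [inner_self_eq_norm_sq_to_K]
    positivity

theorem posSemidef_inner_pow {ι : Type} (k : ℕ) :
    (Matrix.of fun z w : UnitBall ι =>
      (inner ℂ (z : HilbertCoord ι) (w : HilbertCoord ι)) ^ k).PosSemidef := by
  induction k with
  | zero => simpa using posSemidef_gram (fun _ : UnitBall ι => (1 : ℂ))
  | succ k ih => exact ih.hadamard (posSemidef_gram fun z : UnitBall ι => (z : HilbertCoord ι))

/-- The Drury–Arveson kernel is positive semidefinite, so that it has a reproducing kernel Hilbert
space. -/
theorem druryArvesonKernel_posSemidef (ι : Type) : (druryArvesonKernel ι).PosSemidef := by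
  refine ((RKHS.posSemidef_tfae (K := druryArvesonKernel ι)).out 0 2 rfl rfl).mpr ?_
  refine ⟨?_, fun v => ?_⟩
  · ext z w
    simp [druryArvesonKernel, druryArvesonFun, Matrix.conjTranspose_apply,
      ContinuousLinearMap.star_eq_adjoint, ContinuousLinearMap.adjoint_id]
  · have key : ∀ k : ℕ, 0 ≤ v.sum fun x a => v.sum fun x' a' =>
        (star a * (inner ℂ (x' : HilbertCoord ι) (x : HilbertCoord ι)) ^ k * a') := by
      intro k
      have := (posSemidef_inner_pow (ι := ι) k).transpose.2 v
      simpa using this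
    have hs : HasSum (fun k : ℕ => v.sum fun x a => v.sum fun x' a' =>
        (star a * (inner ℂ (x' : HilbertCoord ι) (x : HilbertCoord ι)) ^ k * a'))
        (v.sum fun x a => v.sum fun x' a' =>
          (star a * (1 - inner ℂ (x' : HilbertCoord ι) (x : HilbertCoord ι))⁻¹ * a')) := by
      refine hasSum_sum fun x _ => hasSum_sum fun x' _ => ?_
      exact ((hasSum_geometric_of_norm_lt_one (norm_inner_lt_one x x')).mul_left _).mul_right _
    have h0 := hs.nonneg key
    have h1 := (Complex.le_def.mp h0).1
    simp only [Complex.zero_re] at h1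
    convert h1 using 1
    simp [druryArvesonKernel, druryArvesonFun, mul_comm]

instance instFactDruryArvesonKernel (ι : Type) : Fact (druryArvesonKernel ι).PosSemidef :=
  ⟨druryArvesonKernel_posSemidef ι⟩

/-- The Drury–Arveson space `H²_d`: the Hilbert space of functions on the ball with reproducing
kernel `1 / (1 - ⟨z, w⟩)`. -/
abbrev DruryArveson (ι : Type) : Type := RKHS.OfKernel (druryArvesonKernel ι)

/-- `g` is a multiplier of `H²_d`: it is a function on the ball and `g h ∈ H²_d` for all
`h ∈ H²_d`. -/
def IsMultiplier {ι : Type} (g : UnitBall ι → ℂ) : Prop :=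
  ∀ h : DruryArveson ι, ∃ k : DruryArveson ι, ∀ z : UnitBall ι, k z = g z * h z

/-! ### Weight and frequency data -/

/-- The coefficient sequence of the Dirichlet series `∑ j, b j * (n j)^(-s)`: for injective `n`, the
coefficient of `N^(-s)` is `b j` if `N = n j` and `0` if `N` is none of the `n j`. -/
def dirichletCoeff {ι : Type} (b : ι → ℝ) (n : ι → ℕ) : ℕ → ℂ :=
  Function.extend n (fun j => (b j : ℂ)) 0

/-- Property (P) of a pair consisting of weight data `b` and frequency data `n`. -/
structure PropertyP {ι : Type} (b : ι → ℝ) (n : ι → ℕ) : Prop where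
  two_le : ∀ j, 2 ≤ n j
  injective : Function.Injective n
  pos : ∀ j, 0 < b j
  sum : HasSum b 1 ∨
    (∃ t : ℝ, t < 1 ∧ HasSum b t) ∧ LSeries.abscissaOfAbsConv (dirichletCoeff b n) = 0

theorem PropertyP.hasSum_le {ι : Type} {b : ι → ℝ} {n : ι → ℕ} (hP : PropertyP b n) :
    ∃ t : ℝ, t ≤ 1 ∧ HasSum b t := by
  rcases hP.sum with h | ⟨⟨t, ht, h⟩, -⟩
  · exact ⟨1, le_rfl, h⟩
  · exact ⟨t, ht.le, h⟩

/-- The sequence `(√(b j) * (n j)^(-s))_j`. -/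
def dirichletPoint {ι : Type} (b : ι → ℝ) (n : ι → ℕ) (s : ℂ) : ι → ℂ :=
  fun j => (Real.sqrt (b j) : ℂ) * (n j : ℂ) ^ (-s)

theorem PropertyP.norm_dirichletPoint_sq_le {ι : Type} {b : ι → ℝ} {n : ι → ℕ}
    (hP : PropertyP b n) {s : ℂ} (hs : 0 < s.re) (j : ι) :
    ‖dirichletPoint b n s j‖ ^ 2 ≤ ((2 : ℝ) ^ (-s.re)) ^ 2 * b j := by
  have hn : (0 : ℝ) < n j := by have := hP.two_le j; positivity
  have h1 : ‖(n j : ℂ) ^ (-s)‖ = (n j : ℝ) ^ (-s.re) := by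
    have := Complex.norm_cpow_eq_rpow_re_of_pos hn (-s)
    simpa using this
  have h2 : (n j : ℝ) ^ (-s.re) ≤ (2 : ℝ) ^ (-s.re) :=
    Real.rpow_le_rpow_of_nonpos (by norm_num) (by exact_mod_cast hP.two_le j) (by linarith)
  have h3 : ((n j : ℝ) ^ (-s.re)) ^ 2 ≤ ((2 : ℝ) ^ (-s.re)) ^ 2 :=
    pow_le_pow_left₀ (by positivity) h2 2
  have h4 : ‖dirichletPoint b n s j‖ ^ 2 = b j * ((n j : ℝ) ^ (-s.re)) ^ 2 := by
    rw [dirichletPoint, norm_mul, h1, mul_pow, Complex.norm_real, Real.norm_eq_abs, sq_abs,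
      Real.sq_sqrt (hP.pos j).le]
  rw [h4, mul_comm]
  exact mul_le_mul_of_nonneg_right h3 (hP.pos j).le

theorem PropertyP.memℓp_dirichletPoint {ι : Type} {b : ι → ℝ} {n : ι → ℕ}
    (hP : PropertyP b n) {s : ℂ} (hs : 0 < s.re) :
    Memℓp (E := fun _ : ι => ℂ) (dirichletPoint b n s) 2 := by
  obtain ⟨t, -, hb⟩ := hP.hasSum_le
  refine memℓp_gen ?_
  simp only [ENNReal.toReal_ofNat, Real.rpow_ofNat]
  exact Summable.of_nonneg_of_le (fun j => by positivity)
    (hP.norm_dirichletPoint_sq_le hs) (hb.summable.mul_left _)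

theorem PropertyP.dirichletPoint_mem_ball {ι : Type} {b : ι → ℝ} {n : ι → ℕ}
    (hP : PropertyP b n) {s : ℂ} (hs : 0 < s.re) :
    (⟨dirichletPoint b n s, hP.memℓp_dirichletPoint hs⟩ : HilbertCoord ι) ∈
      Metric.ball (0 : HilbertCoord ι) 1 := by
  obtain ⟨t, ht, hb⟩ := hP.hasSum_le
  set x : HilbertCoord ι := ⟨dirichletPoint b n s, hP.memℓp_dirichletPoint hs⟩ with hx
  have h1 : HasSum (fun j => ‖dirichletPoint b n s j‖ ^ 2) (‖x‖ ^ 2) := by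
    have := lp.hasSum_norm (p := 2) (by norm_num) x
    simpa using this
  have h2 : ‖x‖ ^ 2 ≤ ((2 : ℝ) ^ (-s.re)) ^ 2 * t :=
    _root_.hasSum_le (hP.norm_dirichletPoint_sq_le hs) h1 (hb.mul_left _)
  have h3 : (2 : ℝ) ^ (-s.re) < 1 := Real.rpow_lt_one_of_one_lt_of_neg (by norm_num) (by linarith)
  have h4 : (0 : ℝ) < (2 : ℝ) ^ (-s.re) := by positivity
  have h5 : ‖x‖ ^ 2 < 1 := by nlinarith
  rw [mem_ball_zero_iff]
  nlinarith [norm_nonneg x]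

/-- The map `f : ℍ₀ → 𝔹_d`, `f(s) = (√(b j) * (n j)^(-s))_j`, on the half-plane `Re s > 0`. -/
def dirichletMap {ι : Type} {b : ι → ℝ} {n : ι → ℕ} (hP : PropertyP b n)
    (s : {s : ℂ // 0 < s.re}) : UnitBall ι :=
  ⟨⟨dirichletPoint b n s, hP.memℓp_dirichletPoint s.2⟩, hP.dirichletPoint_mem_ball s.2⟩

/-- The (smallest) multiplier variety of the kernel
`1 / (1 - ∑ j, b j * (n j)^(-s - conj u))`: the common zero set in the ball of all multipliers of
`H²_d` that vanish on `f(ℍ₀)`. -/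
def multiplierVariety {ι : Type} {b : ι → ℝ} {n : ι → ℕ} (hP : PropertyP b n) :
    Set (UnitBall ι) :=
  {z | ∀ g : UnitBall ι → ℂ, IsMultiplier g → (∀ s, g (dirichletMap hP s) = 0) → g z = 0}

/-! ### Similar pattern -/

/-- The collection `𝒥(n)` of the index sets `J` for which the family `(ln n j)_{j ∈ J}` is linearly
dependent over `ℚ` while it is linearly independent over every proper subset of `J`. -/
def minimalDependent {ι : Type} (n : ι → ℕ) : Set (Set ι) :=
  {J | ¬ LinearIndepOn ℚ (fun j => Real.log (n j)) J ∧
    ∀ I, I ⊂ J → LinearIndepOn ℚ (fun j => Real.log (n j)) I}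

/-- `{J₁, J₂}` is a partition of `J`, and `β` is a tuple of positive integers indexed by `J` (stored
as the function extended by `0` off `J`) with greatest common divisor `1`, such that
`∏ i ∈ J₁, n i ^ β i = ∏ i ∈ J₂, n i ^ β i`. For `J` in `𝒥(n)` such data exist, `β` is unique, and
`J₁`, `J₂` are unique up to their order. -/
structure IsAssociated {ι : Type} (n : ι → ℕ) (J : Set ι) (J₁ J₂ : Finset ι) (β : ι →₀ ℕ) :
    Prop where
  nonempty_left : J₁.Nonempty
  nonempty_right : J₂.Nonempty
  disjoint : Disjoint J₁ J₂
  union_eq : (J₁ : Set ι) ∪ (J₂ : Set ι) = J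
  support_eq : (β.support : Set ι) = J
  gcd_eq_one : β.support.gcd β = 1
  prod_eq : ∏ i ∈ J₁, n i ^ β i = ∏ i ∈ J₂, n i ^ β i

/-- The pairs `(b, n)` and `(c, m)` admit a similar pattern: `𝒥(n) = 𝒥(m)`, and for each `J` in this
collection the partition and the tuple associated with `J` through `n` are also those associated
with `J` through `m`, and the weights satisfy the product identity. -/
def SimilarPattern {ι : Type} (b : ι → ℝ) (n : ι → ℕ) (c : ι → ℝ) (m : ι → ℕ) : Prop :=
  minimalDependent n = minimalDependent m ∧
  ∀ J ∈ minimalDependent n, ∃ (J₁ J₂ : Finset ι) (β : ι →₀ ℕ),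
    IsAssociated n J J₁ J₂ β ∧ IsAssociated m J J₁ J₂ β ∧
    (∏ i ∈ J₁, c i ^ β i) * ∏ i ∈ J₂, b i ^ β i = (∏ i ∈ J₂, c i ^ β i) * ∏ i ∈ J₁, b i ^ β i

end

open scoped ComplexConjugate

/-! ### Sums over words -/

/-! Both conditions say that the two pairs obey the same multiplicative relations. Write `x^l` for
the product of the `x j` over the letters of a word `l`.

Since `1 / (1 - ⟨z, w⟩)` is the sum over words of `z^l * conj (w^l)`, every `h` in the Drury–Arveson
space has an expansion `h z = ∑ z^l * a l` with square-summable `a`. At the point `f(s)` this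
becomes a Dirichlet series whose coefficient at `N` is the sum of `√b^l * a l` over the words with
`n^l = N`. If `h` vanishes on `f(ℍ₀)`, uniqueness of Dirichlet coefficients kills each such sum.
Hence the variety is cut out by the binomials `z^l * √b^l' = z^l' * √b^l` with `n^l = n^l'`
(`mem_multiplierVariety_iff`).

Inclusions of varieties thus amount to transfer of relations (`RelationsTransfer`), in the opposite
direction: a smaller variety satisfies more relations.

After taking logarithms, relations become the kernel of a `ℚ`-linear map on finitely supported
vectors. Vectors supported on minimal dependent sets span this kernel (`ker_linearCombination_le`),
so the conditions of a similar pattern, imposed on those sets only, control all relations.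
Conversely, equal relations yield equal minimal sets with the same partitions, tuples and weight
identities. -/

theorem hasSum_prod_tuple {ι : Type} {x : ι → ℂ} (hx : Summable fun j => ‖x j‖) (k : ℕ) :
    (Summable fun v : Fin k → ι => ‖∏ i, x (v i)‖) ∧
      HasSum (fun v : Fin k → ι => ∏ i, x (v i)) ((∑' j, x j) ^ k) := by
  induction k with
  | zero =>
    refine ⟨Summable.of_finite, ?_⟩
    simp
  | succ k ih =>
    have hn : Summable fun p : ι × (Fin k → ι) => ‖x p.1 * ∏ i, x (p.2 i)‖ :=
      Summable.mul_norm (f := x) (g := fun v : Fin k → ι => ∏ i, x (v i)) hx ih.1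
    have hm : HasSum (fun p : ι × (Fin k → ι) => x p.1 * ∏ i, x (p.2 i))
        ((∑' j, x j) * (∑' j, x j) ^ k) :=
      HasSum.mul (f := x) (g := fun v : Fin k → ι => ∏ i, x (v i)) hx.of_norm.hasSum ih.2
        hn.of_norm
    constructor
    · rw [← (Fin.consEquiv fun _ => ι).summable_iff]
      simpa [Function.comp_def, Fin.prod_univ_succ, Fin.consEquiv] using hn
    · rw [← (Fin.consEquiv fun _ => ι).hasSum_iff, pow_succ']
      simpa [Function.comp_def, Fin.prod_univ_succ, Fin.consEquiv] using hm

theorem list_prod_map_ofFn {ι M : Type} [CommMonoid M] (x : ι → M) (p : (k : ℕ) × (Fin k → ι)) :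
    ((List.equivSigmaTuple.symm p).map x).prod = ∏ i, x (p.2 i) := by
  obtain ⟨k, v⟩ := p
  simp [List.equivSigmaTuple, List.map_ofFn, List.prod_ofFn]

/-- Words of length `k` contribute `(∑ x j)^k`, and the lengths form a geometric series. Summability
over words is a separate hypothesis because `‖∑ x j‖ < 1` does not bound `∑ ‖x j‖` by `1`. -/
theorem hasSum_prod_word {ι : Type} {x : ι → ℂ} (hx : Summable fun j => ‖x j‖)
    (h1 : ‖∑' j, x j‖ < 1) (hs : Summable fun l : List ι => (l.map x).prod) :
    HasSum (fun l : List ι => (l.map x).prod) (1 - ∑' j, x j)⁻¹ := by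
  have hs' := List.equivSigmaTuple.symm.summable_iff.mpr hs
  have h2 := List.equivSigmaTuple.symm.hasSum_iff.mpr hs.hasSum
  have h3 := h2.sigma fun k => by
    simpa only [Function.comp_def, list_prod_map_ofFn] using (hasSum_prod_tuple hx k).2
  rw [← h3.unique (hasSum_geometric_of_norm_lt_one h1)]
  exact hs.hasSum

theorem summable_prod_word {ι : Type} {x : ι → ℝ} (hx : Summable x) (h0 : ∀ j, 0 ≤ x j)
    (h1 : ∑' j, x j < 1) : Summable fun l : List ι => (l.map x).prod := by
  have hx' : Summable fun j => ‖(x j : ℂ)‖ := by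
    simpa [abs_of_nonneg (h0 _)] using hx
  have key : ∀ k, HasSum (fun v : Fin k → ι => ∏ i, x (v i)) ((∑' j, x j) ^ k) := by
    intro k
    have := (hasSum_prod_tuple hx' k).2
    rw [← Complex.ofReal_tsum] at this
    exact_mod_cast this
  rw [← List.equivSigmaTuple.symm.summable_iff]
  simp only [Function.comp_def, list_prod_map_ofFn]
  rw [summable_sigma_of_nonneg fun p => Finset.prod_nonneg fun i _ => h0 _]
  refine ⟨fun k => (key k).summable, ?_⟩
  simp only [(key _).tsum_eq]
  exact summable_geometric_of_lt_one (tsum_nonneg h0) h1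

/-! ### The Fock space realization -/

/-- The full Fock space over `ℓ²(ι)`, with coordinates indexed by the words in `ι`. -/
abbrev FockSpace (ι : Type) : Type := lp (fun _ : List ι => ℂ) 2

/-- The squared moduli are the word products of `‖z j‖ ^ 2`, whose sum over `j` is `‖z‖ ^ 2 < 1`. -/
theorem memℓp_wordProd {ι : Type} (z : UnitBall ι) :
    Memℓp (E := fun _ : List ι => ℂ) (fun l => conj (l.map (z : HilbertCoord ι)).prod) 2 := by
  have hz : ‖(z : HilbertCoord ι)‖ < 1 := mem_ball_zero_iff.mp z.2
  have h1 : HasSum (fun j => ‖(z : HilbertCoord ι) j‖ ^ 2) (‖(z : HilbertCoord ι)‖ ^ 2) := by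
    have := lp.hasSum_norm (p := 2) (by norm_num) (z : HilbertCoord ι)
    simpa using this
  refine memℓp_gen ?_
  have := summable_prod_word h1.summable (fun _ => by positivity)
    (by rw [h1.tsum_eq]; nlinarith [norm_nonneg (z : HilbertCoord ι)])
  convert this using 2 with l
  induction l with
  | nil => simp
  | cons a l ih => simp_all [mul_pow]

/-- The vector whose coordinate at a word `l` is the conjugate of the monomial of `l` at `z`. -/
noncomputable def fockFeature {ι : Type} (z : UnitBall ι) : FockSpace ι := ⟨_, memℓp_wordProd z⟩

theorem hasSum_inner_fockFeature {ι : Type} (z : UnitBall ι) (a : FockSpace ι) :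
    HasSum (fun l => (l.map (z : HilbertCoord ι)).prod * a l) (inner ℂ (fockFeature z) a) := by
  have := lp.hasSum_inner (𝕜 := ℂ) (fockFeature z) a
  simpa [fockFeature, mul_comm] using this

theorem list_prod_map_conj {ι : Type} (x : ι → ℂ) (l : List ι) :
    conj (l.map x).prod = (l.map fun j => conj (x j)).prod := by
  induction l with
  | nil => simp
  | cons a l ih => simp [ih]

/-- The geometric series over words for `x j = z j * conj (w j)`. It makes the kernel a Gram matrix
of Fock vectors, so that kernel functions embed isometrically. -/
theorem inner_fockFeature {ι : Type} (z w : UnitBall ι) :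
    inner ℂ (fockFeature z) (fockFeature w) = druryArvesonFun ι z w := by
  have h := hasSum_inner_fockFeature z (fockFeature w)
  have e : (fun l : List ι => (l.map (z : HilbertCoord ι)).prod * fockFeature w l) =
      fun l : List ι => (l.map fun j => inner ℂ ((w : HilbertCoord ι) j)
        ((z : HilbertCoord ι) j)).prod := by
    ext l
    simp only [fockFeature, list_prod_map_conj, RCLike.inner_apply, List.prod_map_mul]
  rw [e] at h
  have hi := lp.hasSum_inner (𝕜 := ℂ) (w : HilbertCoord ι) (z : HilbertCoord ι)
  have := hasSum_prod_word hi.summable.norm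
    (by rw [hi.tsum_eq]; exact norm_inner_lt_one z w) h.summable
  rw [h.unique this, hi.tsum_eq, druryArvesonFun, one_div]

/-- The reproducing kernel function at `w`. -/
noncomputable def kernelVector {ι : Type} (w : UnitBall ι) : DruryArveson ι :=
  RKHS.kerFun (DruryArveson ι) w (1 : ℂ)

theorem inner_kernelVector {ι : Type} (w : UnitBall ι) (h : DruryArveson ι) :
    inner ℂ (kernelVector w) h = h w := by
  simp [kernelVector]

theorem inner_kernelVector_kernelVector {ι : Type} (z w : UnitBall ι) :
    inner ℂ (kernelVector z) (kernelVector w) = druryArvesonFun ι z w := by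
  rw [inner_kernelVector, kernelVector, RKHS.kerFun_apply, RKHS.OfKernel.kernel_ofKernel]
  simp [druryArvesonKernel]

theorem dense_span_kernelVector (ι : Type) :
    DenseRange (Finsupp.linearCombination ℂ (kernelVector : UnitBall ι → DruryArveson ι)) := by
  have h := RKHS.kerFun_dense (DruryArveson ι)
  have e : Submodule.span ℂ {RKHS.kerFun (DruryArveson ι) x v | (x) (v)} =
      LinearMap.range (Finsupp.linearCombination ℂ
        (kernelVector : UnitBall ι → DruryArveson ι)) := by
    rw [Finsupp.range_linearCombination]
    refine le_antisymm (Submodule.span_le.mpr ?_) (Submodule.span_mono ?_)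
    · rintro _ ⟨x, v, rfl⟩
      have : RKHS.kerFun (DruryArveson ι) x v = v • kernelVector x := by
        rw [kernelVector, ← map_smul]; simp
      rw [this]
      exact Submodule.smul_mem _ _ (Submodule.subset_span ⟨x, rfl⟩)
    · rintro _ ⟨x, rfl⟩
      exact ⟨x, 1, rfl⟩
  rw [e, ← Submodule.dense_iff_topologicalClosure_eq_top] at h
  exact h

theorem inner_linearCombination_eq {ι : Type} (u v : UnitBall ι →₀ ℂ) :
    inner ℂ (Finsupp.linearCombination ℂ fockFeature u)
      (Finsupp.linearCombination ℂ fockFeature v) =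
    inner ℂ (Finsupp.linearCombination ℂ kernelVector u)
      (Finsupp.linearCombination ℂ kernelVector v) := by
  simp only [Finsupp.linearCombination_apply, Finsupp.sum_inner, Finsupp.inner_sum,
    inner_smul_left, inner_smul_right, inner_fockFeature, inner_kernelVector_kernelVector]

theorem norm_linearCombination_eq {ι : Type} (u : UnitBall ι →₀ ℂ) :
    ‖Finsupp.linearCombination ℂ fockFeature u‖ =
      ‖Finsupp.linearCombination ℂ (kernelVector : UnitBall ι → DruryArveson ι) u‖ := by
  rw [norm_eq_sqrt_re_inner (𝕜 := ℂ), norm_eq_sqrt_re_inner (𝕜 := ℂ), inner_linearCombination_eq]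

/-- The embedding of the Drury–Arveson space into the Fock space. -/
noncomputable def fockEmbedding (ι : Type) : DruryArveson ι →L[ℂ] FockSpace ι :=
  (Finsupp.linearCombination ℂ fockFeature).extendOfNorm
    (Finsupp.linearCombination ℂ (kernelVector : UnitBall ι → DruryArveson ι))

theorem fockEmbedding_linearCombination {ι : Type} (u : UnitBall ι →₀ ℂ) :
    fockEmbedding ι (Finsupp.linearCombination ℂ kernelVector u) =
      Finsupp.linearCombination ℂ fockFeature u :=
  LinearMap.extendOfNorm_eq (dense_span_kernelVector ι)
    ⟨1, fun u => by rw [one_mul, norm_linearCombination_eq]⟩ u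

theorem fockEmbedding_kernelVector {ι : Type} (z : UnitBall ι) :
    fockEmbedding ι (kernelVector z) = fockFeature z := by
  simpa using fockEmbedding_linearCombination (Finsupp.single z (1 : ℂ))

/-- The adjoint turns a coefficient family into the function it defines. Permuted words give the
same monomial, so coefficients are not unique; only existence matters. -/
theorem adjoint_fockEmbedding_apply {ι : Type} (a : FockSpace ι) (z : UnitBall ι) :
    (fockEmbedding ι).adjoint a z = inner ℂ (fockFeature z) a := by
  rw [← inner_kernelVector, ContinuousLinearMap.adjoint_inner_right, fockEmbedding_kernelVector]

theorem inner_fockFeature_fockEmbedding {ι : Type} (z : UnitBall ι) (h : DruryArveson ι) :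
    inner ℂ (fockFeature z) (fockEmbedding ι h) = h z := by
  rw [← inner_kernelVector]
  refine (dense_span_kernelVector ι).induction_on
    (p := fun h => inner ℂ (fockFeature z) (fockEmbedding ι h) = inner ℂ (kernelVector z) h) h
    (isClosed_eq (by fun_prop) (by fun_prop)) fun u => ?_
  have := inner_linearCombination_eq (Finsupp.single z 1) u
  rw [fockEmbedding_linearCombination]
  simpa using this

/-- Every function in the Drury–Arveson space has a convergent expansion over words. -/
theorem exists_hasSum_word {ι : Type} (h : DruryArveson ι) :
    ∃ a : FockSpace ι, ∀ z : UnitBall ι,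
      HasSum (fun l => (l.map (z : HilbertCoord ι)).prod * a l) (h z) := by
  refine ⟨fockEmbedding ι h, fun z => ?_⟩
  rw [← inner_fockFeature_fockEmbedding]
  exact hasSum_inner_fockFeature z _

/-- Every square-summable family of coefficients defines an element of the Drury–Arveson space. -/
theorem exists_of_coeff {ι : Type} (a : FockSpace ι) :
    ∃ h : DruryArveson ι, ∀ z : UnitBall ι,
      HasSum (fun l => (l.map (z : HilbertCoord ι)).prod * a l) (h z) := by
  refine ⟨(fockEmbedding ι).adjoint a, fun z => ?_⟩
  rw [adjoint_fockEmbedding_apply]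
  exact hasSum_inner_fockFeature z _

/-! ### Multipliers -/

/-- Multiplication by `z j` prepends the letter `j` to every word. This is injective on words, so
the shifted coefficients stay square-summable. -/
theorem isMultiplier_coord {ι : Type} (j : ι) :
    IsMultiplier fun z : UnitBall ι => (z : HilbertCoord ι) j := by
  intro h
  obtain ⟨a, ha⟩ := exists_hasSum_word h
  have hinj : Function.Injective (List.cons j) := List.cons_injective
  have hmem : Memℓp (E := fun _ : List ι => ℂ) (Function.extend (List.cons j) a 0) 2 := by
    refine memℓp_gen ?_
    have h2 := (lp.memℓp a).summable (by norm_num)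
    have e : (fun l : List ι => ‖Function.extend (List.cons j) a 0 l‖ ^ (2 : ENNReal).toReal) =
        Function.extend (List.cons j) (fun l => ‖a l‖ ^ (2 : ENNReal).toReal) 0 := by
      ext l
      by_cases hl : ∃ l', j :: l' = l
      · obtain ⟨l', rfl⟩ := hl
        rw [hinj.extend_apply, hinj.extend_apply]
      · rw [Function.extend_apply' _ _ _ hl, Function.extend_apply' _ _ _ hl]
        simp
    rw [e]
    exact (summable_extend_zero hinj).mpr h2
  obtain ⟨k, hk⟩ := exists_of_coeff ⟨_, hmem⟩
  refine ⟨k, fun z => (hk z).unique ?_⟩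
  rw [← hinj.hasSum_iff]
  · refine ((ha z).mul_left ((z : HilbertCoord ι) j)).congr_fun fun l => ?_
    simp only [Function.comp_apply, hinj.extend_apply, List.map_cons, List.prod_cons]
    ring
  · intro l hl
    simp only
    rw [Function.extend_apply' _ _ _ (by simpa using hl)]
    simp

theorem isMultiplier_one {ι : Type} : IsMultiplier fun _ : UnitBall ι => (1 : ℂ) :=
  fun h => ⟨h, by simp⟩

theorem IsMultiplier.mul {ι : Type} {f g : UnitBall ι → ℂ} (hf : IsMultiplier f)
    (hg : IsMultiplier g) : IsMultiplier fun z => f z * g z := by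
  intro h
  obtain ⟨k, hk⟩ := hg h
  obtain ⟨k', hk'⟩ := hf k
  exact ⟨k', fun z => by rw [hk', hk, mul_assoc]⟩

theorem IsMultiplier.const_mul {ι : Type} {f : UnitBall ι → ℂ} (hf : IsMultiplier f) (c : ℂ) :
    IsMultiplier fun z => f z * c := by
  intro h
  obtain ⟨k, hk⟩ := hf h
  refine ⟨c • k, fun z => ?_⟩
  rw [RKHS.coe_smul, Pi.smul_apply, hk, smul_eq_mul]
  ring

theorem IsMultiplier.sub {ι : Type} {f g : UnitBall ι → ℂ} (hf : IsMultiplier f)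
    (hg : IsMultiplier g) : IsMultiplier fun z => f z - g z := by
  intro h
  obtain ⟨k, hk⟩ := hf h
  obtain ⟨k', hk'⟩ := hg h
  refine ⟨k - k', fun z => ?_⟩
  rw [RKHS.coe_sub, Pi.sub_apply, hk, hk', sub_mul]

theorem isMultiplier_word {ι : Type} (l : List ι) :
    IsMultiplier fun z : UnitBall ι => (l.map (z : HilbertCoord ι)).prod := by
  induction l with
  | nil => simpa using isMultiplier_one
  | cons j l ih => simpa using (isMultiplier_coord j).mul ih

/-- The constant `1` is the kernel function at the origin, so a multiplier is its own product with
an element of the space. -/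
theorem IsMultiplier.exists_eq {ι : Type} {g : UnitBall ι → ℂ} (hg : IsMultiplier g) :
    ∃ h : DruryArveson ι, ∀ z, h z = g z := by
  have h0 : ∀ z : UnitBall ι, kernelVector (⟨0, by simp⟩ : UnitBall ι) z = 1 := by
    intro z
    rw [← inner_kernelVector, inner_kernelVector_kernelVector]
    simp [druryArvesonFun]
  obtain ⟨k, hk⟩ := hg (kernelVector ⟨0, by simp⟩)
  exact ⟨k, fun z => by rw [hk, h0, mul_one]⟩

/-! ### The multiplier variety is cut out by binomials -/

theorem list_prod_map_dirichletPoint {ι : Type} (b : ι → ℝ) (n : ι → ℕ) (s : ℂ) (l : List ι) :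
    (l.map (dirichletPoint b n s)).prod =
      (l.map fun j => (Real.sqrt (b j) : ℂ)).prod * ((l.map n).prod : ℂ) ^ (-s) := by
  induction l with
  | nil => simp
  | cons j l ih =>
    simp only [List.map_cons, List.prod_cons, ih, dirichletPoint, Nat.cast_mul]
    rw [Complex.natCast_mul_natCast_cpow]
    ring

theorem PropertyP.list_prod_ne_zero {ι : Type} {b : ι → ℝ} {n : ι → ℕ} (hP : PropertyP b n)
    (l : List ι) : (l.map n).prod ≠ 0 := by
  intro h
  obtain ⟨j, -, hj⟩ := List.mem_map.mp (List.prod_eq_zero_iff.mp h)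
  have := hP.two_le j
  omega

theorem PropertyP.list_prod_sqrt_ne_zero {ι : Type} {b : ι → ℝ} {n : ι → ℕ} (hP : PropertyP b n)
    (l : List ι) : (l.map fun j => (Real.sqrt (b j) : ℂ)).prod ≠ 0 := by
  intro h
  obtain ⟨j, -, hj⟩ := List.mem_map.mp (List.prod_eq_zero_iff.mp h)
  exact (Real.sqrt_pos.mpr (hP.pos j)).ne' (by exact_mod_cast hj)

theorem HasSum.tsum_fiber {α : Type} {f : α → ℂ} {t : ℂ} (hf : HasSum f t) (p : α → ℕ) :
    HasSum (fun N => ∑' l : {l // p l = N}, f l) t := by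
  have h := (Equiv.sigmaFiberEquiv p).hasSum_iff.mpr hf
  exact h.sigma fun N => (h.summable.sigma_factor N).hasSum

/-- A family of coefficients whose associated Dirichlet series vanishes on `Re s > 0` has vanishing
sums over the words with a given frequency. -/
theorem PropertyP.tsum_fiber_eq_zero {ι : Type} {b : ι → ℝ} {n : ι → ℕ} (hP : PropertyP b n)
    {a : List ι → ℂ}
    (ha : ∀ s : ℂ, 0 < s.re → HasSum (fun l => (l.map (dirichletPoint b n s)).prod * a l) 0)
    (N : ℕ) :
    ∑' l : {l : List ι // (l.map n).prod = N},
      ((l : List ι).map fun j => (Real.sqrt (b j) : ℂ)).prod * a l = 0 := by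
  set F : ℕ → ℂ := fun N => ∑' l : {l : List ι // (l.map n).prod = N},
      ((l : List ι).map fun j => (Real.sqrt (b j) : ℂ)).prod * a l with hF
  have hF0 : F 0 = 0 := by
    have : IsEmpty {l : List ι // (l.map n).prod = 0} :=
      ⟨fun l => hP.list_prod_ne_zero _ l.2⟩
    exact tsum_empty
  have key : ∀ s : ℂ, 0 < s.re → LSeriesHasSum F s 0 := by
    intro s hs
    refine ((ha s hs).tsum_fiber fun l => (l.map n).prod).congr_fun fun N => ?_
    rcases eq_or_ne N 0 with rfl | hN
    · rw [LSeries.term_zero]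
      have : IsEmpty {l : List ι // (l.map n).prod = 0} :=
        ⟨fun l => hP.list_prod_ne_zero _ l.2⟩
      exact tsum_empty.symm
    · rw [LSeries.term_of_ne_zero hN, div_eq_mul_inv, ← Complex.cpow_neg, hF, ← tsum_mul_right]
      refine tsum_congr fun l => ?_
      rw [list_prod_map_dirichletPoint, l.2]
      ring
  -- Convergence at `s = 1` excludes the degenerate alternative of the uniqueness theorem, in which
  -- the series converges nowhere.
  have habs : LSeries.abscissaOfAbsConv F ≠ ⊤ := by
    have := (key 1 (by simp)).LSeriesSummable.abscissaOfAbsConv_le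
    exact (this.trans_lt (EReal.coe_lt_top _)).ne
  have hev : (fun x : ℝ => LSeries F x) =ᶠ[Filter.atTop] 0 := by
    filter_upwards [Filter.eventually_gt_atTop 0] with x hx
    exact (key x (by simpa using hx)).LSeries_eq
  rcases eq_or_ne N 0 with rfl | hN
  · exact hF0
  · exact (LSeries_eventually_eq_zero_iff'.mp hev).resolve_right habs N hN

/-- Each binomial is a multiplier vanishing on the image of `f`. Conversely, at a common zero of the
binomials the expansion of a vanishing multiplier, grouped by the value `N` of `n^l`, is zero group
by group. -/
theorem mem_multiplierVariety_iff {ι : Type} {b : ι → ℝ} {n : ι → ℕ} (hP : PropertyP b n)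
    (z : UnitBall ι) :
    z ∈ multiplierVariety hP ↔ ∀ l l' : List ι, (l.map n).prod = (l'.map n).prod →
      (l.map (z : HilbertCoord ι)).prod * (l'.map fun j => (Real.sqrt (b j) : ℂ)).prod =
        (l'.map (z : HilbertCoord ι)).prod * (l.map fun j => (Real.sqrt (b j) : ℂ)).prod := by
  constructor
  · intro hz l l' hl
    have := hz _ (((isMultiplier_word l).const_mul
      (l'.map fun j => (Real.sqrt (b j) : ℂ)).prod).sub ((isMultiplier_word l').const_mul
      (l.map fun j => (Real.sqrt (b j) : ℂ)).prod)) (fun s => ?_)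
    · exact sub_eq_zero.mp this
    · change (l.map (dirichletPoint b n s)).prod * _ - (l'.map (dirichletPoint b n s)).prod * _ = 0
      rw [list_prod_map_dirichletPoint, list_prod_map_dirichletPoint, hl]
      ring
  · intro hz g hg hgf
    obtain ⟨h, hh⟩ := hg.exists_eq
    obtain ⟨a, ha⟩ := exists_hasSum_word h
    have hfib := hP.tsum_fiber_eq_zero (a := a) fun s hs => by
      have := ha (dirichletMap hP ⟨s, hs⟩)
      rw [hh, hgf] at this
      exact this
    have hsum := (ha z).tsum_fiber fun l => (l.map n).prod
    rw [← hh]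
    refine hsum.unique ?_
    convert hasSum_zero using 2 with N
    by_cases hN : ∃ l₀ : List ι, (l₀.map n).prod = N
    · obtain ⟨l₀, hl₀⟩ := hN
      -- On the fibre of `N` the binomials force `z^l = (z^l₀ / √b^l₀) * √b^l`, so the fibre sum is
      -- a multiple of the one in `hfib`.
      have hb := hP.list_prod_sqrt_ne_zero l₀
      rw [← mul_zero ((l₀.map (z : HilbertCoord ι)).prod /
        (l₀.map fun j => (Real.sqrt (b j) : ℂ)).prod), ← hfib N, ← tsum_mul_left]
      refine tsum_congr fun l => ?_
      have := hz l l₀ (l.2.trans hl₀.symm)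
      field_simp
      linear_combination a l * this
    · have : IsEmpty {l : List ι // (l.map n).prod = N} := ⟨fun l => hN ⟨l, l.2⟩⟩
      exact tsum_empty

/-! ### Monomials with finitely supported exponents -/

/-- The monomial with exponent `α` at `x`. -/
noncomputable def monomialAt {ι M : Type} [CommMonoid M] (x : ι → M) (α : ι →₀ ℕ) : M :=
  α.prod fun i k => x i ^ k

theorem monomialAt_toFinsupp {ι M : Type} [CommMonoid M] [DecidableEq ι] (x : ι → M)
    (l : Multiset ι) : monomialAt x (Multiset.toFinsupp l) = (l.map x).prod := by
  induction l using Multiset.induction with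
  | empty => simp [monomialAt]
  | cons a l ih =>
    rw [← Multiset.singleton_add, map_add, monomialAt,
      Finsupp.prod_add_index' (by simp) (by simp [pow_add])]
    rw [monomialAt] at ih
    simp [ih]

theorem monomialAt_pos {ι : Type} {x : ι → ℝ} (hx : ∀ j, 0 < x j) (α : ι →₀ ℕ) :
    0 < monomialAt x α :=
  Finset.prod_pos fun i _ => pow_pos (hx i) _

theorem monomialAt_natCast {ι : Type} (n : ι → ℕ) (α : ι →₀ ℕ) :
    monomialAt (fun j => (n j : ℝ)) α = (monomialAt n α : ℕ) := by
  simp [monomialAt, Finsupp.prod]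

theorem monomialAt_ofReal {ι : Type} (x : ι → ℝ) (α : ι →₀ ℕ) :
    monomialAt (fun j => (x j : ℂ)) α = (monomialAt x α : ℝ) := by
  simp [monomialAt, Finsupp.prod]

theorem monomialAt_sqrt_sq {ι : Type} {x : ι → ℝ} (hx : ∀ j, 0 < x j) (α : ι →₀ ℕ) :
    monomialAt (fun j => Real.sqrt (x j)) α ^ 2 = monomialAt x α := by
  simp only [monomialAt, Finsupp.prod, ← Finset.prod_pow]
  refine Finset.prod_congr rfl fun i _ => ?_
  rw [← pow_mul, mul_comm, pow_mul, Real.sq_sqrt (hx i).le]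

theorem monomialAt_div {ι : Type} (x y : ι → ℝ) (α : ι →₀ ℕ) :
    monomialAt (fun j => x j / y j) α = monomialAt x α / monomialAt y α := by
  simp [monomialAt, Finsupp.prod, div_pow, Finset.prod_div_distrib]

theorem mem_multiplierVariety_iff_monomialAt {ι : Type} {b : ι → ℝ} {n : ι → ℕ}
    (hP : PropertyP b n) (z : UnitBall ι) :
    z ∈ multiplierVariety hP ↔ ∀ α α' : ι →₀ ℕ, monomialAt n α = monomialAt n α' →
      monomialAt (z : HilbertCoord ι) α * monomialAt (fun j => Real.sqrt (b j)) α' =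
        monomialAt (z : HilbertCoord ι) α' * monomialAt (fun j => Real.sqrt (b j)) α := by
  classical
  rw [mem_multiplierVariety_iff]
  have e : ∀ {M : Type} [CommMonoid M] (x : ι → M) (l : List ι),
      (l.map x).prod = monomialAt x (Multiset.toFinsupp (l : Multiset ι)) := by
    intro M _ x l
    rw [monomialAt_toFinsupp, Multiset.map_coe, Multiset.prod_coe]
  have hsurj : ∀ α : ι →₀ ℕ, ∃ l : List ι, Multiset.toFinsupp (l : Multiset ι) = α := by
    intro α
    exact ⟨(Finsupp.toMultiset α).toList, by simp⟩
  constructor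
  · intro h α α' hα
    obtain ⟨l, rfl⟩ := hsurj α
    obtain ⟨l', rfl⟩ := hsurj α'
    have := h l l' (by rw [e, e, hα])
    simp only [e] at this
    rwa [monomialAt_ofReal, monomialAt_ofReal] at this
  · intro h l l' hl
    rw [e, e] at hl
    simp only [e]
    rw [monomialAt_ofReal, monomialAt_ofReal]
    exact h _ _ hl

/-! ### Relations between the data and equality of the varieties -/

/-- Every multiplicative relation among the `n j` holds for the `m j`, and for the ratios of the
weights. -/
def RelationsTransfer {ι : Type} (b : ι → ℝ) (n : ι → ℕ) (c : ι → ℝ) (m : ι → ℕ) : Prop :=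
  ∀ α α' : ι →₀ ℕ, monomialAt n α = monomialAt n α' →
    monomialAt m α = monomialAt m α' ∧
      monomialAt c α * monomialAt b α' = monomialAt c α' * monomialAt b α

theorem monomialAt_sqrt_mul_eq_iff {ι : Type} {b c : ι → ℝ} (hb : ∀ j, 0 < b j)
    (hc : ∀ j, 0 < c j) (α α' : ι →₀ ℕ) :
    monomialAt (fun j => Real.sqrt (c j)) α * monomialAt (fun j => Real.sqrt (b j)) α' =
        monomialAt (fun j => Real.sqrt (c j)) α' * monomialAt (fun j => Real.sqrt (b j)) α ↔
      monomialAt c α * monomialAt b α' = monomialAt c α' * monomialAt b α := by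
  have p : ∀ {x : ι → ℝ} (_ : ∀ j, 0 < x j) (γ : ι →₀ ℕ),
      0 < monomialAt (fun j => Real.sqrt (x j)) γ :=
    fun hx γ => monomialAt_pos (fun j => Real.sqrt_pos.mpr (hx j)) γ
  rw [← monomialAt_sqrt_sq hb, ← monomialAt_sqrt_sq hb, ← monomialAt_sqrt_sq hc,
    ← monomialAt_sqrt_sq hc, ← mul_pow, ← mul_pow,
    sq_eq_sq₀ (mul_pos (p hc _) (p hb _)).le (mul_pos (p hc _) (p hb _)).le]

theorem PropertyP.monomialAt_pos {ι : Type} {b : ι → ℝ} {n : ι → ℕ} (hP : PropertyP b n)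
    (α : ι →₀ ℕ) : 0 < monomialAt n α :=
  Finset.prod_pos fun i _ => pow_pos (by have := hP.two_le i; omega) _

theorem monomialAt_dirichletPoint {ι : Type} (b : ι → ℝ) (n : ι → ℕ) (s : ℂ) (α : ι →₀ ℕ) :
    monomialAt (dirichletPoint b n s) α =
      ((monomialAt (fun j => Real.sqrt (b j)) α : ℝ) : ℂ) * ((monomialAt n α : ℕ) : ℂ) ^ (-s) := by
  classical
  obtain ⟨l, rfl⟩ : ∃ l : List ι, Multiset.toFinsupp (l : Multiset ι) = α :=
    ⟨(Finsupp.toMultiset α).toList, by simp⟩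
  rw [← monomialAt_ofReal]
  simp only [monomialAt_toFinsupp, Multiset.map_coe, Multiset.prod_coe]
  exact list_prod_map_dirichletPoint b n s l

/-- A relation among the `m j` is also one among the `n j`, so `z` satisfies its binomial with
weights `b`; the weight identity replaces `√b` by `√c`. -/
theorem RelationsTransfer.multiplierVariety_subset {ι : Type} {b c : ι → ℝ} {n m : ι → ℕ}
    (hbn : PropertyP b n) (hcm : PropertyP c m) (h : RelationsTransfer c m b n) :
    multiplierVariety hbn ⊆ multiplierVariety hcm := by
  intro z hz
  rw [mem_multiplierVariety_iff_monomialAt] at hz ⊢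
  intro α α' hα
  obtain ⟨h1, h2⟩ := h α α' hα
  have h3 := hz α α' h1
  have h4 := (monomialAt_sqrt_mul_eq_iff hcm.pos hbn.pos α α').mpr h2
  have hb := (monomialAt_pos (fun j => Real.sqrt_pos.mpr (hbn.pos j)) α').ne'
  rw [← Complex.ofReal_inj] at h4
  push_cast at h4
  rw [← Complex.ofReal_ne_zero] at hb
  refine mul_right_cancel₀ hb ?_
  linear_combination ((monomialAt (fun j => Real.sqrt (c j)) α' : ℝ) : ℂ) * h3 +
    monomialAt (z : HilbertCoord ι) α' * h4

theorem RelationsTransfer.of_multiplierVariety_subset {ι : Type} {b c : ι → ℝ} {n m : ι → ℕ}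
    (hbn : PropertyP b n) (hcm : PropertyP c m)
    (h : multiplierVariety hcm ⊆ multiplierVariety hbn) : RelationsTransfer b n c m := by
  intro α α' hα
  -- Evaluate the binomial at the points of the curve of `(c, m)` with parameter `s = k`; two values
  -- of `k` will separate the frequencies from the weights.
  have key : ∀ k : ℕ, 0 < k →
      monomialAt (fun j => Real.sqrt (c j)) α * monomialAt (fun j => Real.sqrt (b j)) α' *
          ((monomialAt m α' : ℕ) : ℝ) ^ k =
        monomialAt (fun j => Real.sqrt (c j)) α' * monomialAt (fun j => Real.sqrt (b j)) α *
          ((monomialAt m α : ℕ) : ℝ) ^ k := by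
    intro k hk
    have hmem : dirichletMap hcm ⟨(k : ℂ), by simpa using hk⟩ ∈ multiplierVariety hcm :=
      fun g _ hg => hg _
    have h1 := (mem_multiplierVariety_iff_monomialAt hbn _).mp (h hmem) α α' hα
    change monomialAt (dirichletPoint c m k) α * _ = monomialAt (dirichletPoint c m k) α' * _ at h1
    rw [monomialAt_dirichletPoint, monomialAt_dirichletPoint, Complex.cpow_neg, Complex.cpow_neg,
      Complex.cpow_natCast, Complex.cpow_natCast] at h1
    have p := (hcm.monomialAt_pos α).ne'
    have p' := (hcm.monomialAt_pos α').ne'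
    rw [← Complex.ofReal_inj]
    push_cast
    field_simp at h1
    linear_combination h1
  have k1 := key 1 one_pos
  have k2 := key 2 two_pos
  have p : (0 : ℝ) < monomialAt m α := by exact_mod_cast hcm.monomialAt_pos α
  have p' : (0 : ℝ) < monomialAt m α' := by exact_mod_cast hcm.monomialAt_pos α'
  have q := mul_pos (monomialAt_pos (fun j => Real.sqrt_pos.mpr (hcm.pos j)) α)
    (monomialAt_pos (fun j => Real.sqrt_pos.mpr (hbn.pos j)) α')
  -- With `A`, `B` the weight factors and `M`, `M'` the values of `m` at `α`, `α'`, the equations `A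
  -- M' = B M` and `A M'² = B M²` give `A M' M = A M'²`, hence `M = M'`.
  have hm : ((monomialAt m α : ℕ) : ℝ) = monomialAt m α' := by
    refine mul_left_cancel₀ (mul_pos q p').ne' ?_
    linear_combination ((monomialAt m α : ℕ) : ℝ) * k1 - k2
  refine ⟨by exact_mod_cast hm, (monomialAt_sqrt_mul_eq_iff hbn.pos hcm.pos α α').mp ?_⟩
  rw [hm] at k1
  exact mul_right_cancel₀ (by simpa using p'.ne') k1

/-! ### Circuits of a family of logarithms -/

/-- A rationally dependent finite set contains a minimal one. -/
theorem exists_minimal_dependent {ι M : Type} [AddCommGroup M] [Module ℚ M] (v : ι → M)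
    (S : Finset ι) (hS : ¬ LinearIndepOn ℚ v (S : Set ι)) :
    ∃ J : Finset ι, J ⊆ S ∧ ¬ LinearIndepOn ℚ v (J : Set ι) ∧
      ∀ I : Set ι, I ⊂ J → LinearIndepOn ℚ v I := by
  obtain ⟨J, hJS, hJ⟩ := exists_minimal_le_of_wellFoundedLT
    (fun T : Finset ι => ¬ LinearIndepOn ℚ v (T : Set ι)) S hS
  refine ⟨J, hJS, hJ.prop, fun I hI => ?_⟩
  have hfin : I.Finite := J.finite_toSet.subset hI.subset
  by_contra hcon
  obtain ⟨T, rfl⟩ := hfin.exists_finset_coe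
  exact hJ.not_lt (y := T) hcon (by exact_mod_cast hI)

/-- A submodule containing, for each minimal dependent set `J`, a relation with support `J`
contains all relations. -/
theorem ker_linearCombination_le {ι M : Type} [AddCommGroup M] [Module ℚ M] (v : ι → M)
    (W : Submodule ℚ (ι →₀ ℚ))
    (hW : ∀ J : Finset ι, ¬ LinearIndepOn ℚ v (J : Set ι) →
      (∀ I : Set ι, I ⊂ J → LinearIndepOn ℚ v I) →
      ∃ u ∈ W, u.support = J ∧ Finsupp.linearCombination ℚ v u = 0) :
    LinearMap.ker (Finsupp.linearCombination ℚ v) ≤ W := by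
  classical
  have key : ∀ (k : ℕ) (w : ι →₀ ℚ), w.support.card = k →
      Finsupp.linearCombination ℚ v w = 0 → w ∈ W := by
    intro k
    induction k using Nat.strong_induction_on with
    | _ k ih =>
      intro w hk hw
      rcases eq_or_ne w 0 with rfl | hw0
      · exact W.zero_mem
      have hdep : ¬ LinearIndepOn ℚ v (w.support : Set ι) := fun hind =>
        hw0 (linearIndepOn_iff.mp hind w (Finsupp.mem_supported_support ℚ w) hw)
      obtain ⟨J, hJS, hJ, hmin⟩ := exists_minimal_dependent v _ hdep
      obtain ⟨u, huW, hu, hu0⟩ := hW J hJ hmin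
      have hJne : J.Nonempty := by
        rw [Finset.nonempty_iff_ne_empty]
        rintro rfl
        exact hJ (by simp)
      obtain ⟨j, hj⟩ := hJne
      have huj : u j ≠ 0 := by rwa [← Finsupp.mem_support_iff, hu]
      have hwj : w j ≠ 0 := by rw [← Finsupp.mem_support_iff]; exact hJS hj
      -- Subtracting this multiple of `u` cancels the coordinate `j`, and adds none since the
      -- support `J` of `u` lies in that of `w`; the support shrinks strictly.
      have hlt : (w - (w j / u j) • u).support ⊂ w.support := by
        refine Finset.ssubset_iff_subset_ne.mpr ⟨fun i hi => ?_, fun he => ?_⟩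
        · by_contra hwi
          have hui : u i = 0 := by
            by_contra h
            exact hwi (hJS (hu ▸ Finsupp.mem_support_iff.mpr h))
          rw [Finsupp.notMem_support_iff] at hwi
          rw [Finsupp.mem_support_iff] at hi
          simp [hwi, hui] at hi
        · have : j ∈ (w - (w j / u j) • u).support := by rw [he]; exact hJS hj
          rw [Finsupp.mem_support_iff] at this
          simp [huj] at this
      have := ih _ (hk ▸ Finset.card_lt_card hlt) _ rfl (by simp [hw, hu0])
      have h2 := W.add_mem this (W.smul_mem (w j / u j) huW)
      simpa using h2
  exact fun w hw => key _ w rfl hw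

/-- The rational vector of a difference of exponents. -/
noncomputable def exponentDiff {ι : Type} (α α' : ι →₀ ℕ) : ι →₀ ℚ :=
  α.mapRange Nat.cast Nat.cast_zero - α'.mapRange Nat.cast Nat.cast_zero

theorem exponentDiff_apply {ι : Type} (α α' : ι →₀ ℕ) (i : ι) :
    exponentDiff α α' i = (α i : ℚ) - α' i := by
  simp [exponentDiff]

theorem linearCombination_log {ι : Type} {x : ι → ℝ} (hx : ∀ j, 0 < x j) (α : ι →₀ ℕ) :
    Finsupp.linearCombination ℚ (fun j => Real.log (x j))
      (α.mapRange Nat.cast Nat.cast_zero) = Real.log (monomialAt x α) := by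
  rw [Finsupp.linearCombination_apply, Finsupp.sum_mapRange_index (by simp), monomialAt,
    Finsupp.prod, Real.log_prod fun i _ => (pow_pos (hx i) _).ne']
  refine Finset.sum_congr rfl fun i _ => ?_
  simp [Real.log_pow, Rat.smul_def]

theorem monomialAt_eq_iff {ι : Type} {x : ι → ℝ} (hx : ∀ j, 0 < x j) (α α' : ι →₀ ℕ) :
    monomialAt x α = monomialAt x α' ↔
      Finsupp.linearCombination ℚ (fun j => Real.log (x j)) (exponentDiff α α') = 0 := by
  rw [exponentDiff, map_sub, linearCombination_log hx, linearCombination_log hx, sub_eq_zero]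
  exact ⟨fun h => by rw [h], fun h => Real.log_injOn_pos (monomialAt_pos hx α)
    (monomialAt_pos hx α') h⟩

theorem PropertyP.cast_pos {ι : Type} {b : ι → ℝ} {n : ι → ℕ} (hP : PropertyP b n) (j : ι) :
    (0 : ℝ) < n j := by
  have := hP.two_le j
  positivity

theorem PropertyP.monomialAt_eq_iff {ι : Type} {b : ι → ℝ} {n : ι → ℕ} (hP : PropertyP b n)
    (α α' : ι →₀ ℕ) : monomialAt n α = monomialAt n α' ↔
      Finsupp.linearCombination ℚ (fun j => Real.log (n j)) (exponentDiff α α') = 0 := by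
  rw [← _root_.monomialAt_eq_iff hP.cast_pos, monomialAt_natCast, monomialAt_natCast, Nat.cast_inj]

/-- The weight identity is a multiplicative relation among the ratios `c j / b j`, hence a linear
condition on the exponent difference. -/
theorem monomialAt_mul_eq_iff {ι : Type} {b c : ι → ℝ} (hb : ∀ j, 0 < b j) (hc : ∀ j, 0 < c j)
    (α α' : ι →₀ ℕ) : monomialAt c α * monomialAt b α' = monomialAt c α' * monomialAt b α ↔
      Finsupp.linearCombination ℚ (fun j => Real.log (c j / b j)) (exponentDiff α α') = 0 := by
  rw [← monomialAt_eq_iff fun j => div_pos (hc j) (hb j), monomialAt_div, monomialAt_div,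
    div_eq_div_iff (monomialAt_pos hb α).ne' (monomialAt_pos hb α').ne']

theorem filter_mem_left {ι : Type} [DecidableEq ι] {n : ι → ℕ} {J : Set ι} {J₁ J₂ : Finset ι}
    {β : ι →₀ ℕ} (h : IsAssociated n J J₁ J₂ β) : β.support.filter (· ∈ J₁) = J₁ := by
  ext i
  have := h.support_eq ▸ h.union_eq
  have hi := Set.ext_iff.mp this i
  simp only [Set.mem_union, Finset.mem_coe] at hi
  simp only [Finset.mem_filter]
  tauto

theorem IsAssociated.symm {ι : Type} {n : ι → ℕ} {J : Set ι} {J₁ J₂ : Finset ι} {β : ι →₀ ℕ}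
    (h : IsAssociated n J J₁ J₂ β) : IsAssociated n J J₂ J₁ β :=
  ⟨h.nonempty_right, h.nonempty_left, h.disjoint.symm, by rw [Set.union_comm, h.union_eq],
    h.support_eq, h.gcd_eq_one, h.prod_eq.symm⟩

theorem IsAssociated.monomialAt_left {ι M : Type} [CommMonoid M] [DecidableEq ι] {n : ι → ℕ}
    {J : Set ι} {J₁ J₂ : Finset ι} {β : ι →₀ ℕ} (h : IsAssociated n J J₁ J₂ β) (x : ι → M) :
    monomialAt x (β.filter (· ∈ J₁)) = ∏ i ∈ J₁, x i ^ β i := by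
  rw [monomialAt, Finsupp.prod, Finsupp.support_filter, filter_mem_left h]
  refine Finset.prod_congr rfl fun i hi => ?_
  rw [Finsupp.filter_apply_pos _ _ hi]

/-- As `J₁` and `J₂` are disjoint, nothing cancels: the entries on `J` are `± β i`. -/
theorem IsAssociated.support_exponentDiff {ι : Type} [DecidableEq ι] {n : ι → ℕ} {J : Set ι}
    {J₁ J₂ : Finset ι} {β : ι →₀ ℕ} (h : IsAssociated n J J₁ J₂ β) :
    ((exponentDiff (β.filter (· ∈ J₁)) (β.filter (· ∈ J₂))).support : Set ι) = J := by
  rw [← h.support_eq]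
  ext i
  have hi := Set.ext_iff.mp (h.support_eq ▸ h.union_eq) i
  have hd : i ∈ J₁ → i ∉ J₂ := fun h1 => Finset.disjoint_left.mp h.disjoint h1
  simp only [Set.mem_union, Finset.mem_coe, Finsupp.mem_support_iff] at hi
  simp only [Finset.mem_coe, Finsupp.mem_support_iff, exponentDiff_apply, Finsupp.filter_apply]
  by_cases h1 : i ∈ J₁ <;> by_cases h2 : i ∈ J₂ <;> simp_all

theorem SimilarPattern.symm {ι : Type} {b c : ι → ℝ} {n m : ι → ℕ} (h : SimilarPattern b n c m) :
    SimilarPattern c m b n := by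
  refine ⟨h.1.symm, fun J hJ => ?_⟩
  obtain ⟨J₁, J₂, β, h1, h2, h3⟩ := h.2 J (h.1 ▸ hJ)
  exact ⟨J₁, J₂, β, h2, h1, by linear_combination -h3⟩

/-- The vectors giving a relation both among the `m j` and among the ratios `c j / b j` form a
subspace. The pattern places a vector of full support on each minimal dependent set in it, so it
contains every relation among the `n j`. -/
theorem SimilarPattern.relationsTransfer {ι : Type} {b c : ι → ℝ} {n m : ι → ℕ}
    (hbn : PropertyP b n) (hcm : PropertyP c m) (h : SimilarPattern b n c m) :
    RelationsTransfer b n c m := by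
  classical
  have hle := ker_linearCombination_le (fun j => Real.log (n j))
    (LinearMap.ker (Finsupp.linearCombination ℚ fun j => Real.log (m j)) ⊓
      LinearMap.ker (Finsupp.linearCombination ℚ fun j => Real.log (c j / b j))) ?_
  · intro α α' hα
    have := hle ((hbn.monomialAt_eq_iff α α').mp hα)
    exact ⟨(hcm.monomialAt_eq_iff α α').mpr this.1,
      (monomialAt_mul_eq_iff hbn.pos hcm.pos α α').mpr this.2⟩
  · intro J hJ hmin
    obtain ⟨J₁, J₂, β, h1, h2, h3⟩ := h.2 J ⟨hJ, hmin⟩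
    refine ⟨exponentDiff (β.filter (· ∈ J₁)) (β.filter (· ∈ J₂)), ⟨?_, ?_⟩, ?_, ?_⟩
    · refine (hcm.monomialAt_eq_iff _ _).mp ?_
      rw [h2.monomialAt_left, h2.symm.monomialAt_left, h2.prod_eq]
    · refine (monomialAt_mul_eq_iff hbn.pos hcm.pos _ _).mp ?_
      simpa only [h2.monomialAt_left, h2.symm.monomialAt_left] using h3
    · exact_mod_cast h1.support_exponentDiff
    · refine (hbn.monomialAt_eq_iff _ _).mp ?_
      rw [h1.monomialAt_left, h1.symm.monomialAt_left, h1.prod_eq]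

/-! ### Existence of the associated partition and tuple -/

/-- A rational vector has a positive integer multiple that is a difference of exponents. -/
theorem exists_smul_eq_exponentDiff {ι : Type} (w : ι →₀ ℚ) :
    ∃ k : ℚ, k ≠ 0 ∧ ∃ α α' : ι →₀ ℕ, k • w = exponentDiff α α' := by
  classical
  set D : ℕ := ∏ i ∈ w.support, (w i).den with hD
  have hD0 : D ≠ 0 := Finset.prod_ne_zero_iff.mpr fun i _ => (w i).den_nz
  have hint : ∀ i, ∃ t : ℤ, (D : ℚ) * w i = t := by
    intro i
    by_cases hi : i ∈ w.support
    · obtain ⟨e, he⟩ := Finset.dvd_prod_of_mem (fun i => (w i).den) hi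
      refine ⟨e * (w i).num, ?_⟩
      have := Rat.mul_den_eq_num (w i)
      rw [hD, he]
      push_cast
      linear_combination (e : ℚ) * this
    · exact ⟨0, by simp [Finsupp.notMem_support_iff.mp hi]⟩
  choose t ht using hint
  have ht0 : ∀ i, t i ≠ 0 → i ∈ w.support := by
    intro i hi
    rw [Finsupp.mem_support_iff]
    intro h
    have := ht i
    rw [h, mul_zero] at this
    exact hi (by exact_mod_cast this.symm)
  -- The exponents are the positive and negative parts of the integers `t i = D * w i`.
  refine ⟨D, by exact_mod_cast hD0,
    Finsupp.onFinset w.support (fun i => (t i).toNat) fun i hi => ht0 i (by rintro h; simp [h] at hi),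
    Finsupp.onFinset w.support (fun i => (-t i).toNat)
      fun i hi => ht0 i (by rintro h; simp [h] at hi), ?_⟩
  ext i
  rw [exponentDiff_apply, Finsupp.smul_apply, smul_eq_mul, ht]
  simp only [Finsupp.onFinset_apply]
  have : t i = ((t i).toNat : ℤ) - ((-t i).toNat : ℤ) := by omega
  exact_mod_cast congrArg (Int.cast : ℤ → ℚ) this

/-- By minimality a nonzero relation on `J` has support exactly `J`, so `J` is finite. Clear
denominators, divide by the greatest common divisor, and split `J` by sign. -/
theorem PropertyP.exists_isAssociated {ι : Type} {b : ι → ℝ} {n : ι → ℕ} (hP : PropertyP b n)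
    {J : Set ι} (hJ : J ∈ minimalDependent n) :
    ∃ (J₁ J₂ : Finset ι) (β : ι →₀ ℕ), IsAssociated n J J₁ J₂ β := by
  classical
  obtain ⟨hdep, hmin⟩ := hJ
  rw [linearIndepOn_iff] at hdep
  push Not at hdep
  obtain ⟨w, hwJ, hw, hw0⟩ := hdep
  have hsupp : (w.support : Set ι) = J := by
    by_contra hne
    have hss : (w.support : Set ι) ⊂ J := lt_of_le_of_ne ((Finsupp.mem_supported ℚ w).mp hwJ) hne
    exact hw0 (linearIndepOn_iff.mp (hmin _ hss) w (Finsupp.mem_supported_support ℚ w) hw)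
  obtain ⟨k, hk, α, α', he⟩ := exists_smul_eq_exponentDiff w
  set g : ℕ := w.support.gcd fun i => ((α i : ℤ) - α' i).natAbs with hg
  have hne : ∀ i, i ∈ w.support ↔ ((α i : ℤ) - α' i).natAbs ≠ 0 := by
    intro i
    have h1 : k * w i = (α i : ℚ) - α' i := by
      rw [← exponentDiff_apply, ← he, Finsupp.smul_apply, smul_eq_mul]
    rw [Finsupp.mem_support_iff, Int.natAbs_ne_zero, show (w i ≠ 0 ↔ k * w i ≠ 0) by simp [hk], h1]
    exact_mod_cast Iff.rfl
  have hwne : w.support.Nonempty := Finsupp.support_nonempty_iff.mpr hw0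
  obtain ⟨i₀, hi₀⟩ := hwne
  have hgdvd : ∀ i, g ∣ ((α i : ℤ) - α' i).natAbs := by
    intro i
    by_cases hi : i ∈ w.support
    · exact Finset.gcd_dvd hi
    · rw [hne, not_not] at hi
      rw [hi]; exact dvd_zero _
  have hg0 : g ≠ 0 := fun h0 => (hne i₀).mp hi₀ (Nat.eq_zero_of_zero_dvd (h0 ▸ hgdvd i₀))
  set β : ι →₀ ℕ := Finsupp.onFinset w.support (fun i => ((α i : ℤ) - α' i).natAbs / g)
    (fun i hi => (hne i).mpr fun h => by simp [h] at hi) with hβ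
  have hβg : ∀ i, g * β i = ((α i : ℤ) - α' i).natAbs := fun i => Nat.mul_div_cancel' (hgdvd i)
  have hβs : β.support = w.support := by
    ext i
    rw [hne, ← hβg, Finsupp.mem_support_iff]
    simp [hg0]
  have hdiff : (g : ℚ) • exponentDiff (β.filter (· ∈ w.support.filter fun i => α' i < α i))
      (β.filter (· ∈ w.support.filter fun i => α i < α' i)) = exponentDiff α α' := by
    ext i
    have h1 := hβg i
    have h2 := hne i
    rw [Finsupp.smul_apply, exponentDiff_apply, exponentDiff_apply, smul_eq_mul]
    simp only [Finsupp.filter_apply, Finset.mem_filter]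
    rcases lt_trichotomy (α i) (α' i) with h | h | h
    · have hi : i ∈ w.support := h2.mpr (by omega)
      have h3 : g * β i + α i = α' i := by rw [h1]; omega
      have h4 : (g : ℚ) * β i + α i = α' i := by exact_mod_cast h3
      simp only [hi, h, h.not_gt, and_true, and_false, if_true, if_false, Nat.cast_zero]
      linear_combination -h4
    · simp [h]
    · have hi : i ∈ w.support := h2.mpr (by omega)
      have h3 : g * β i + α' i = α i := by rw [h1]; omega
      have h4 : (g : ℚ) * β i + α' i = α i := by exact_mod_cast h3
      simp only [hi, h, h.not_gt, and_true, and_false, if_true, if_false, Nat.cast_zero]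
      linear_combination h4
  have hrel : monomialAt n (β.filter (· ∈ w.support.filter fun i => α' i < α i)) =
      monomialAt n (β.filter (· ∈ w.support.filter fun i => α i < α' i)) := by
    rw [hP.monomialAt_eq_iff]
    have hgq : (g : ℚ) ≠ 0 := by exact_mod_cast hg0
    refine (smul_eq_zero.mp ?_).resolve_left hgq
    rw [← map_smul, hdiff, ← he, map_smul, hw, smul_zero]
  have hfilter : ∀ T : Finset ι, T ⊆ w.support →
      monomialAt n (β.filter (· ∈ T)) = ∏ i ∈ T, n i ^ β i := by
    intro T hT
    rw [monomialAt, Finsupp.prod, Finsupp.support_filter, hβs, Finset.filter_mem_eq_inter,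
      Finset.inter_eq_right.mpr hT]
    refine Finset.prod_congr rfl fun i hi => ?_
    rw [Finsupp.filter_apply_pos _ _ hi]
  rw [hfilter _ (Finset.filter_subset _ _), hfilter _ (Finset.filter_subset _ _)] at hrel
  -- Since `n i ≥ 2` and the exponents are positive, a nonempty product exceeds `1`; hence neither
  -- side of the relation can be empty.
  have hgt : ∀ T : Finset ι, T ⊆ w.support → T.Nonempty → ∏ i ∈ T, n i ^ β i ≠ 1 := by
    intro T hT hTne h1
    obtain ⟨i, hi⟩ := hTne
    have h2 := (Finset.prod_eq_one_iff.mp h1) i hi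
    have h3 : β i ≠ 0 := Finsupp.mem_support_iff.mp (hβs ▸ hT hi)
    have h4 := hP.two_le i
    rcases Nat.pow_eq_one.mp h2 with h | h <;> omega
  have hunion : (w.support.filter fun i => α' i < α i) ∪ (w.support.filter fun i => α i < α' i) =
      w.support := by
    ext i
    have h2 := hne i
    simp only [Finset.mem_union, Finset.mem_filter]
    constructor
    · tauto
    · intro hi
      rcases lt_trichotomy (α i) (α' i) with h | h | h
      · exact Or.inr ⟨hi, h⟩
      · exact absurd (by simp [h]) (h2.mp hi)
      · exact Or.inl ⟨hi, h⟩
  refine ⟨w.support.filter fun i => α' i < α i, w.support.filter fun i => α i < α' i, β,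
    ?_, ?_, ?_, ?_, ?_, ?_, hrel⟩
  · rw [Finset.nonempty_iff_ne_empty]
    intro h
    rw [h, Finset.prod_empty] at hrel
    rw [h, Finset.empty_union] at hunion
    exact hgt _ (Finset.filter_subset _ _) ⟨i₀, by rwa [hunion]⟩ hrel.symm
  · rw [Finset.nonempty_iff_ne_empty]
    intro h
    rw [h, Finset.prod_empty] at hrel
    rw [h, Finset.union_empty] at hunion
    exact hgt _ (Finset.filter_subset _ _) ⟨i₀, by rwa [hunion]⟩ hrel
  · rw [Finset.disjoint_left]
    intro i h1 h2
    rw [Finset.mem_filter] at h1 h2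
    omega
  · rw [← Finset.coe_union, hunion, hsupp]
  · rw [hβs, hsupp]
  · rw [hβs]
    exact Finset.gcd_div_eq_one hi₀ ((hne i₀).mp hi₀)

theorem RelationsTransfer.ker_le {ι : Type} {b c : ι → ℝ} {n m : ι → ℕ}
    (hbn : PropertyP b n) (hcm : PropertyP c m) (h : RelationsTransfer b n c m) (w : ι →₀ ℚ)
    (hw : Finsupp.linearCombination ℚ (fun j => Real.log (n j)) w = 0) :
    Finsupp.linearCombination ℚ (fun j => Real.log (m j)) w = 0 := by
  obtain ⟨k, hk, α, α', he⟩ := exists_smul_eq_exponentDiff w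
  have h1 := (h α α' ((hbn.monomialAt_eq_iff α α').mpr (by rw [← he, map_smul, hw, smul_zero]))).1
  rw [hcm.monomialAt_eq_iff, ← he, map_smul] at h1
  exact (smul_eq_zero.mp h1).resolve_left hk

/-- Transfer in both directions makes the two families of logarithms have the same relations, hence
the same independent sets. The data associated through `n` then serve for `m`, as the defining
relation transfers together with its weight identity. -/
theorem RelationsTransfer.similarPattern {ι : Type} {b c : ι → ℝ} {n m : ι → ℕ}
    (hbn : PropertyP b n) (hcm : PropertyP c m) (h : RelationsTransfer b n c m)
    (h' : RelationsTransfer c m b n) : SimilarPattern b n c m := by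
  classical
  have hind : ∀ J : Set ι, LinearIndepOn ℚ (fun j => Real.log (n j)) J ↔
      LinearIndepOn ℚ (fun j => Real.log (m j)) J := by
    intro J
    rw [linearIndepOn_iff, linearIndepOn_iff]
    exact ⟨fun H l hl hl0 => H l hl (h'.ker_le hcm hbn l hl0),
      fun H l hl hl0 => H l hl (h.ker_le hbn hcm l hl0)⟩
  refine ⟨by simp only [minimalDependent, hind], fun J hJ => ?_⟩
  obtain ⟨J₁, J₂, β, hA⟩ := hbn.exists_isAssociated hJ
  obtain ⟨hm, hw⟩ := h (β.filter (· ∈ J₁)) (β.filter (· ∈ J₂))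
    (by rw [hA.monomialAt_left, hA.symm.monomialAt_left, hA.prod_eq])
  simp only [hA.monomialAt_left, hA.symm.monomialAt_left] at hm hw
  exact ⟨J₁, J₂, β, hA, ⟨hA.nonempty_left, hA.nonempty_right, hA.disjoint, hA.union_eq,
    hA.support_eq, hA.gcd_eq_one, hm⟩, hw⟩

theorem proposition5p5 (d : ℕ∞) (hd : 2 ≤ d) (b c : Idx d → ℝ) (n m : Idx d → ℕ)
    (hbn : PropertyP b n) (hcm : PropertyP c m) :
    SimilarPattern b n c m ↔ multiplierVariety hbn = multiplierVariety hcm := by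
  constructor
  · intro h
    exact Set.Subset.antisymm
      ((h.symm.relationsTransfer hcm hbn).multiplierVariety_subset hbn hcm)
      ((h.relationsTransfer hbn hcm).multiplierVariety_subset hcm hbn)
  · intro h
    exact (RelationsTransfer.of_multiplierVariety_subset hbn hcm h.ge).similarPattern hbn hcm
      (RelationsTransfer.of_multiplierVariety_subset hcm hbn h.le)
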